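/- Let $(X,\mathcal B,m)$ be a $\sigma$-finite measure space with $m\neq 0$ and let $T:X\to X$ be a conservative, ergodic, measure preserving transformation. For $A\in\mathcal B$ and $x\in A$ let $\varphi_A(x):=\min\{n\ge 1: T^nx\in A\}$ (finite for a.e. $x\in A$), and let $$\mathcal F_{\log,T}:=\Big\{A\in\mathcal B:\ 0<m(A)<\infty,\ \int_A\log\varphi_A\,dm<\infty\Big\}.$$ Call $T$ *log-lower bounded* (LLB) if $\mathcal F_{\log,T}\neq\emptyset$. Let $L^1(m)_+:=\{f\in L^1(m): f\ge 0,\ \int_X f\,dm>0\}$ and $S_n(f):=\sum_{k=0}^{n-1}f\circ T^k$. (i) $T$ is LLB if and only if $\frac1{\log n}S_n(f)\to\infty$ a.e. as $n\to\infty$ for some $f\in L^1(m)_+$, and also if and only if this holds for all $f\in L^1(m)_+$. (ii) $T$ is not LLB if and only if $\liminf_{n\to\infty}\frac1{\log n}S_n(f)=0$ a.e. for some $f\in L^1(m)_+$, and also if and only if this holds for all $f\in L^1(m)_+$. (iii) If $T$ is LLB and $\mathcal C\subset\mathcal B$ is a factor, that is, a sub-$\sigma$-algebra with $T^{-1}\mathcal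 C\subset\mathcal C$ on which $m$ is $\sigma$-finite, then $\mathcal C\cap\mathcal F_{\log,T}\neq\emptyset$. (iv) $\mathcal F_{\log,T}$ is, up to null sets, a hereditary ring: the collection $\mathcal F_{\log,T}\cup\{N\in\mathcal B: m(N)=0\}$ contains $\emptyset$, is closed under finite unions and differences, and contains every $B\in\mathcal B$ that is a subset of one of its members. -/

import Mathlib

open MeasureTheory Filter Topology

noncomputable section

namespace LogLowerBounded

/-- The first return time `φ_A(x) = min {n ≥ 1 : T^n x ∈ A}`.  For a conservative `T` and a measurable
set `A`, almost every `x ∈ A` returns to `A`, so the value `0` given to the points that never return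
is only taken on a null subset of `A`. -/
def returnTime {X : Type*} (T : X → X) (A : Set X) (x : X) : ℕ :=
  sInf {n : ℕ | 1 ≤ n ∧ T^[n] x ∈ A}

/-- The class `F_{log,T}` of measurable sets `A` with `0 < m(A) < ∞` and `∫_A log φ_A dm < ∞`.
The integrand is nonnegative and the integral is the Lebesgue integral with values in `[0, ∞]`. -/
def FLog {X : Type*} {_ : MeasurableSpace X} (T : X → X) (m : Measure X) : Set (Set X) :=
  {A | MeasurableSet A ∧ 0 < m A ∧ m A < ⊤ ∧
    ∫⁻ x in A, ENNReal.ofReal (Real.log (returnTime T A x : ℝ)) ∂m < ⊤}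

/-- `T` is log-lower bounded (LLB). -/
def IsLLB {X : Type*} [MeasurableSpace X] (T : X → X) (m : Measure X) : Prop :=
  (FLog T m).Nonempty

/-- The class `L^1(m)_+` of integrable functions `f ≥ 0` (almost everywhere) with `∫ f dm > 0`. -/
def L1Pos {X : Type*} [MeasurableSpace X] (m : Measure X) : Set (X → ℝ) :=
  {f | Integrable f m ∧ 0 ≤ᵐ[m] f ∧ 0 < ∫ x, f x ∂m}

/-- The normalized ergodic sum `(1 / log n) ∑_{k < n} f(T^k x)`. -/
def logAverage {X : Type*} (T : X → X) (f : X → ℝ) (n : ℕ) (x : X) : ℝ :=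
  (1 / Real.log (n : ℝ)) * birkhoffSum T f n x

/-- A factor: a sub-σ-algebra `C` of the given one with `T⁻¹ C ⊆ C` on which `m` is σ-finite. -/
structure IsFactor {X : Type*} {B : MeasurableSpace X} (T : X → X) (m : Measure X)
    (C : MeasurableSpace X) : Prop where
  le : C ≤ B
  invariant : ∀ A : Set X, MeasurableSet[C] A → MeasurableSet[C] (T ⁻¹' A)
  sigmaFinite : SigmaFinite (m.trim le)

/-- A ring of sets that contains every measurable subset of each of its members. -/
structure IsHereditaryRing {X : Type*} [MeasurableSpace X] (R : Set (Set X)) : Prop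
    extends IsSetRing R where
  hereditary : ∀ A ∈ R, ∀ B : Set X, MeasurableSet B → B ⊆ A → B ∈ R

end LogLowerBounded

end

/-!
Everything rests on Kac's inequality `∫_A ∑_{k < φ_A} g ∘ T^k ≤ ∫ g`
(`lintegral_sum_returnTime_le`).

* If `log n ≤ C S_n(f)` for all `n ≥ N` and all `x` in a set `A` of finite positive measure, then
  `log φ_A ≤ log N + C S_{φ_A}(f)` on `A`, and Kac's inequality gives `∫_A log φ_A < ∞`.  Such a set
  exists unless `liminf S_n(f) / log n = 0` almost everywhere
  (`isLLB_of_not_ae_liminf_eq_zero`).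
* The inequality `log (1 + n) ≤ S_n(1_A log (1 + φ_A))` on `A` (`log_one_add_le_birkhoffSum`) and
  Kac's inequality for `B ⊆ A` show that `F_{log,T}` is hereditary (`FLog.mono`).
* Kac's inequality also shows that the induced map on `A` does not increase the measure of
  preimages, so for `A ∈ F_{log,T}` the Borel–Cantelli lemma makes the logarithm of the `i`-th gap
  between visits to `A` of order `o(i)`.  The time of the `j`-th visit is then `exp (o(j))`, that is,
  `log n = o(S_n(1_A))` (`FLog.ae_exists_log_le_visits`).  Given `f ≥ c 1_B`, applying this to a subset
  `A ∩ T⁻ᵏ B` of `A`, which is in `F_{log,T}` by heredity, yields `S_n(f) / log n → ∞`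
  (`FLog.ae_tendsto_logAverage`) without a ratio ergodic theorem.

These facts give the dichotomy between the limit `∞` and the lower limit `0`.  For a factor, the first
of them is applied to the restricted measure and the last one to the original measure.
-/

namespace LogLowerBounded

variable {X : Type*}

/-! ### Return times -/

section Combinatorics

variable {T : X → X} {A B : Set X} {x : X} {k : ℕ}

theorem iterate_returnTime_mem (h : returnTime T A x ≠ 0) : T^[returnTime T A x] x ∈ A :=
  (Nat.sInf_mem (Nat.nonempty_of_pos_sInf (Nat.pos_of_ne_zero h))).2

theorem iterate_notMem_of_lt_returnTime (hk : 1 ≤ k) (h : k < returnTime T A x) : T^[k] x ∉ A :=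
  fun hmem => Nat.notMem_of_lt_sInf h ⟨hk, hmem⟩

theorem returnTime_le (hk : 1 ≤ k) (h : T^[k] x ∈ A) : returnTime T A x ≤ k :=
  Nat.sInf_le ⟨hk, h⟩

theorem one_le_returnTime (hk : 1 ≤ k) (h : T^[k] x ∈ A) : 1 ≤ returnTime T A x :=
  (Nat.sInf_mem (s := {n : ℕ | 1 ≤ n ∧ T^[n] x ∈ A}) ⟨k, hk, h⟩).1

theorem returnTime_anti (hAB : A ⊆ B) (h : returnTime T A x ≠ 0) :
    returnTime T B x ≤ returnTime T A x :=
  returnTime_le (Nat.one_le_iff_ne_zero.2 h) (hAB (iterate_returnTime_mem h))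

/-- The points of `A` whose orbit visits `A` infinitely often. -/
def recurrentPart (T : X → X) (A : Set X) : Set X :=
  {x | x ∈ A ∧ ∃ᶠ n in atTop, T^[n] x ∈ A}

theorem one_le_returnTime_of_mem_recurrentPart (hx : x ∈ recurrentPart T A) :
    1 ≤ returnTime T A x := by
  obtain ⟨n, hn, hmem⟩ := frequently_atTop.1 hx.2 1
  exact one_le_returnTime hn hmem

theorem iterate_mem_recurrentPart (hx : x ∈ recurrentPart T A) (hk : T^[k] x ∈ A) :
    T^[k] x ∈ recurrentPart T A := by
  refine ⟨hk, frequently_atTop.2 fun a => ?_⟩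
  obtain ⟨n, hn, hmem⟩ := frequently_atTop.1 hx.2 (a + k)
  refine ⟨n - k, by omega, ?_⟩
  rw [← Function.iterate_add_apply, Nat.sub_add_cancel (by omega)]
  exact hmem

/-- The induced transformation `x ↦ T^{φ_A(x)} x`; it fixes the points that never return to `A`. -/
noncomputable def inducedMap (T : X → X) (A : Set X) (x : X) : X :=
  T^[returnTime T A x] x

theorem inducedMap_mem_recurrentPart (hx : x ∈ recurrentPart T A) :
    inducedMap T A x ∈ recurrentPart T A :=
  iterate_mem_recurrentPart hx (iterate_returnTime_mem
    (Nat.one_le_iff_ne_zero.1 (one_le_returnTime_of_mem_recurrentPart hx)))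

theorem inducedMap_iterate_mem_recurrentPart (hx : x ∈ recurrentPart T A) (j : ℕ) :
    (inducedMap T A)^[j] x ∈ recurrentPart T A := by
  induction j with
  | zero => exact hx
  | succ j ih =>
    rw [Function.iterate_succ_apply']
    exact inducedMap_mem_recurrentPart ih

theorem inducedMap_iterate (j : ℕ) :
    (inducedMap T A)^[j] x = T^[birkhoffSum (inducedMap T A) (returnTime T A) j x] x := by
  induction j with
  | zero => simp
  | succ j ih =>
    rw [Function.iterate_succ_apply', birkhoffSum_succ, add_comm, Function.iterate_add_apply, ← ih]
    rfl

/-- The number of `k < n` with `T^k x ∈ A`. -/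
noncomputable def visits (T : X → X) (A : Set X) (n : ℕ) (x : X) : ℕ :=
  birkhoffSum T (A.indicator fun _ => 1) n x

/-- If `j` is the number of visits before time `n`, then the visit with index `j` (counted from
`0`) happens at time `n` or later. -/
theorem le_birkhoffSum_returnTime_visits (hx : x ∈ recurrentPart T A) (n : ℕ) :
    n ≤ birkhoffSum (inducedMap T A) (returnTime T A) (visits T A n x) x := by
  induction n with
  | zero => exact Nat.zero_le _
  | succ n ih =>
    have hmem := inducedMap_iterate_mem_recurrentPart hx (visits T A n x)
    have hstep : visits T A (n + 1) x = visits T A n x + A.indicator (fun _ => 1) (T^[n] x) :=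
      birkhoffSum_succ _ _ _ _
    by_cases hn : T^[n] x ∈ A
    · rw [hstep, Set.indicator_of_mem hn, birkhoffSum_succ]
      have := one_le_returnTime_of_mem_recurrentPart hmem
      omega
    · rw [hstep, Set.indicator_of_notMem hn, add_zero]
      refine Nat.succ_le_of_lt (lt_of_le_of_ne ih fun h => hn ?_)
      rw [inducedMap_iterate, ← h] at hmem
      exact hmem.1

/-- Since the gaps between consecutive visits add up to at least `n`, this is a form of
`1 + ∑ a_i ≤ ∏ (1 + a_i)`. -/
theorem log_one_add_le_birkhoffSum (n : ℕ) : ∀ {x : X}, x ∈ recurrentPart T A →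
    Real.log (1 + n) ≤
      birkhoffSum T (A.indicator fun y => Real.log (1 + returnTime T A y)) n x := by
  have hnonneg : ∀ y, 0 ≤ A.indicator (fun y => Real.log (1 + returnTime T A y)) y :=
    Set.indicator_nonneg fun y _ => Real.log_nonneg (by simp)
  induction n using Nat.strong_induction_on with
  | _ n ih =>
    intro x hx
    have hp := one_le_returnTime_of_mem_recurrentPart hx
    have hfirst : ∀ n, 1 ≤ n → Real.log (1 + returnTime T A x) ≤
        birkhoffSum T (A.indicator fun y => Real.log (1 + returnTime T A y)) n x := by
      intro n hn
      obtain ⟨k, rfl⟩ := Nat.exists_eq_add_of_le' hn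
      rw [birkhoffSum_succ', Set.indicator_of_mem hx.1]
      exact le_add_of_nonneg_right (Finset.sum_nonneg fun _ _ => hnonneg _)
    rcases Nat.eq_zero_or_pos n with rfl | hn
    · simp
    by_cases hnp : n ≤ returnTime T A x
    · refine le_trans (Real.log_le_log (by positivity) ?_) (hfirst n hn)
      gcongr
    · obtain ⟨q, hq⟩ := Nat.exists_eq_add_of_lt (not_le.1 hnp)
      set p := returnTime T A x with hpdef
      have hih := ih (q + 1) (by omega) (inducedMap_mem_recurrentPart hx)
      have hsum := birkhoffSum_add T
        (A.indicator fun y => Real.log (1 + (returnTime T A y : ℝ))) p (q + 1) x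
      have hnq : n = p + (q + 1) := by omega
      rw [hnq, hsum]
      refine le_trans ?_ (add_le_add (hfirst p hp) hih)
      rw [← Real.log_mul (by positivity) (by positivity)]
      refine Real.log_le_log (by positivity) ?_
      push_cast
      nlinarith [mul_nonneg (Nat.cast_nonneg (α := ℝ) p) (by positivity : (0 : ℝ) ≤ (q : ℝ) + 1)]

/-- The operator `g ↦ (1_{Aᶜ} g) ∘ T`.  Its `k`-th iterate applied to `g` is `g ∘ T^k`, restricted to
the points that do not visit `A` at the times `1, …, k`. -/
noncomputable def tailOperator (T : X → X) (A : Set X) (g : X → ENNReal) (x : X) : ENNReal :=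
  Aᶜ.indicator g (T x)

theorem tailOperator_iterate_apply {k : ℕ} {x : X} (h : ∀ i, 1 ≤ i → i ≤ k → T^[i] x ∉ A)
    (g : X → ENNReal) : (tailOperator T A)^[k] g x = g (T^[k] x) := by
  induction k generalizing g with
  | zero => rfl
  | succ k ih =>
    rw [Function.iterate_succ_apply, ih fun i h1 hi => h i h1 (by omega), tailOperator,
      ← Function.iterate_succ_apply' T]
    exact Set.indicator_of_mem (h (k + 1) (by omega) le_rfl) g

end Combinatorics

/-! ### Measurability of return times -/

section Measure

variable [MeasurableSpace X] {m : Measure X} {T : X → X} {A B : Set X}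

theorem measurable_returnTime (hT : Measurable T) (hA : MeasurableSet A) :
    Measurable (returnTime T A) := by
  have hmeas : ∀ k, MeasurableSet {x | T^[k] x ∈ A} := fun k => hT.iterate k hA
  have hlevel : ∀ n, 1 ≤ n → MeasurableSet (returnTime T A ⁻¹' {n}) := by
    intro n hn
    have : returnTime T A ⁻¹' {n} =
        {x | T^[n] x ∈ A} ∩ ⋂ k ∈ Finset.Ico 1 n, {x | T^[k] x ∈ A}ᶜ := by
      ext x
      simp only [Set.mem_preimage, Set.mem_singleton_iff, Set.mem_inter_iff, Set.mem_iInter,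
        Finset.mem_Ico, Set.mem_compl_iff, Set.mem_ofPred_eq]
      constructor
      · rintro rfl
        exact ⟨iterate_returnTime_mem (by omega),
          fun k hk => iterate_notMem_of_lt_returnTime hk.1 hk.2⟩
      · rintro ⟨hmem, hlt⟩
        have hpos := one_le_returnTime hn hmem
        refine le_antisymm (returnTime_le hn hmem) (not_lt.1 fun h => ?_)
        exact hlt _ ⟨hpos, h⟩ (iterate_returnTime_mem (by omega))
    rw [this]
    exact (hmeas n).inter (Finset.measurableSet_biInter _ fun k _ => (hmeas k).compl)
  refine measurable_to_countable' fun n => ?_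
  rcases Nat.eq_zero_or_pos n with rfl | hn
  · have : returnTime T A ⁻¹' {0} = (⋃ n, returnTime T A ⁻¹' {n + 1})ᶜ := by
      ext x
      simp only [Set.mem_preimage, Set.mem_singleton_iff, Set.mem_compl_iff, Set.mem_iUnion,
        not_exists]
      exact ⟨fun h n => by omega, fun h => by_contra fun h' =>
        h _ (Nat.succ_pred_eq_of_ne_zero h').symm⟩
    rw [this]
    exact (MeasurableSet.iUnion fun n => hlevel (n + 1) (by omega)).compl
  · exact hlevel n hn

theorem measurable_inducedMap (hT : Measurable T) (hA : MeasurableSet A) :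
    Measurable (inducedMap T A) := by
  have : Measurable fun p : X × ℕ => T^[p.2] p.1 :=
    measurable_from_prod_countable_left fun n => hT.iterate n
  exact this.comp (measurable_id.prodMk (measurable_returnTime hT hA))

theorem ae_mem_recurrentPart (hcons : Conservative T m) (hA : MeasurableSet A) :
    ∀ᵐ x ∂m, x ∈ A → x ∈ recurrentPart T A := by
  filter_upwards [hcons.ae_mem_imp_frequently_image_mem hA.nullMeasurableSet] with x hx hxA
  exact ⟨hxA, hx hxA⟩

/-! ### Kac's inequality -/

theorem lintegral_comp_eq (hT : MeasurePreserving T m m) {g : X → ENNReal}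
    (hg : AEMeasurable g m) : ∫⁻ x, g (T x) ∂m = ∫⁻ x, g x ∂m := by
  rw [← lintegral_map' (by rwa [hT.map_eq]) hT.aemeasurable, hT.map_eq]

theorem aemeasurable_tailOperator (hT : MeasurePreserving T m m) (hA : MeasurableSet A)
    {g : X → ENNReal} (hg : AEMeasurable g m) : AEMeasurable (tailOperator T A g) m :=
  (hg.indicator hA.compl).comp_quasiMeasurePreserving hT.quasiMeasurePreserving

theorem aemeasurable_tailOperator_iterate (hT : MeasurePreserving T m m) (hA : MeasurableSet A)
    {g : X → ENNReal} (hg : AEMeasurable g m) (k : ℕ) :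
    AEMeasurable ((tailOperator T A)^[k] g) m := by
  induction k with
  | zero => exact hg
  | succ k ih =>
    rw [Function.iterate_succ_apply']
    exact aemeasurable_tailOperator hT hA ih

/-- Iterating `∫ g = ∫_A g + ∫ 1_{Aᶜ} g = ∫_A g + ∫ (1_{Aᶜ} g) ∘ T`. -/
theorem sum_lintegral_tailOperator_le (hT : MeasurePreserving T m m) (hA : MeasurableSet A)
    {g : X → ENNReal} (hg : AEMeasurable g m) (n : ℕ) :
    ∑ k ∈ Finset.range n, ∫⁻ x in A, (tailOperator T A)^[k] g x ∂m ≤ ∫⁻ x, g x ∂m := by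
  induction n generalizing g with
  | zero => simp
  | succ n ih =>
    have htail : ∫⁻ x, tailOperator T A g x ∂m = ∫⁻ x in Aᶜ, g x ∂m := by
      rw [← lintegral_indicator hA.compl]
      exact lintegral_comp_eq hT (hg.indicator hA.compl)
    rw [Finset.sum_range_succ', add_comm, ← lintegral_add_compl g hA, ← htail]
    exact add_le_add le_rfl (ih (aemeasurable_tailOperator hT hA hg))

/-- **Kac's inequality**: the excursions from `A` sweep out at most the whole space. -/
theorem lintegral_sum_returnTime_le (hT : MeasurePreserving T m m) (hA : MeasurableSet A)
    {g : X → ENNReal} (hg : AEMeasurable g m) :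
    ∫⁻ x in A, ∑ k ∈ Finset.range (returnTime T A x), g (T^[k] x) ∂m ≤ ∫⁻ x, g x ∂m := by
  calc
    _ ≤ ∫⁻ x in A, ∑' k, (tailOperator T A)^[k] g x ∂m := by
      refine lintegral_mono fun x => ?_
      refine le_trans (Finset.sum_le_sum fun k hk => ?_)
        (ENNReal.sum_le_tsum (Finset.range (returnTime T A x)))
      refine (tailOperator_iterate_apply (fun i h1 hi => ?_) g).ge
      exact iterate_notMem_of_lt_returnTime h1 (hi.trans_lt (Finset.mem_range.1 hk))
    _ = ∑' k, ∫⁻ x in A, (tailOperator T A)^[k] g x ∂m :=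
      lintegral_tsum fun k => (aemeasurable_tailOperator_iterate hT hA hg k).restrict
    _ ≤ _ := ENNReal.tsum_le_of_sum_range_le fun n => sum_lintegral_tailOperator_le hT hA hg n

/-- Kac's inequality for a real function that dominates `F` along excursions. -/
theorem lintegral_ofReal_le_of_le_birkhoffSum (hT : MeasurePreserving T m m)
    (hA : MeasurableSet A) {f F : X → ℝ} (hf : AEMeasurable f m) (hf0 : 0 ≤ᵐ[m] f)
    (hF : ∀ᵐ x ∂m, x ∈ A → F x ≤ birkhoffSum T f (returnTime T A x) x) :
    ∫⁻ x in A, ENNReal.ofReal (F x) ∂m ≤ ∫⁻ x, ENNReal.ofReal (f x) ∂m := by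
  refine le_trans (lintegral_mono_ae ?_) (lintegral_sum_returnTime_le hT hA hf.ennreal_ofReal)
  rw [ae_restrict_iff' hA]
  have hf0' : ∀ᵐ x ∂m, ∀ k, 0 ≤ f (T^[k] x) :=
    ae_all_iff.2 fun k => (hT.iterate k).quasiMeasurePreserving.ae hf0
  filter_upwards [hF, hf0'] with x hx h0 hxA
  rw [← ENNReal.ofReal_sum_of_nonneg fun k _ => h0 k]
  exact ENNReal.ofReal_le_ofReal (hx hxA)

/-- The induced transformation does not increase the measure of preimages. -/
theorem measure_inter_preimage_inducedMap_le (hT : MeasurePreserving T m m)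
    (hcons : Conservative T m) (hA : MeasurableSet A) {E : Set X} (hE : MeasurableSet E) :
    m (A ∩ inducedMap T A ⁻¹' E) ≤ m E := by
  have hmeas : MeasurableSet (inducedMap T A ⁻¹' E) := measurable_inducedMap hT.measurable hA hE
  -- The last summand of the excursion sum of `1_E ∘ T` is `1_E` at the point of return.
  have hK := lintegral_sum_returnTime_le hT hA (m := m)
    (g := (T ⁻¹' E).indicator 1)
    ((measurable_one.indicator (hT.measurable hE)).aemeasurable)
  rw [lintegral_indicator_one (hT.measurable hE), hT.measure_preimage hE.nullMeasurableSet] at hK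
  refine le_trans ?_ hK
  rw [Set.inter_comm, ← Measure.restrict_apply hmeas, ← lintegral_indicator_one hmeas]
  refine lintegral_mono_ae ?_
  rw [ae_restrict_iff' hA]
  filter_upwards [ae_mem_recurrentPart hcons hA] with x hx hxA
  have hp := one_le_returnTime_of_mem_recurrentPart (hx hxA)
  by_cases hxE : x ∈ inducedMap T A ⁻¹' E
  swap
  · rw [Set.indicator_of_notMem hxE]
    exact zero_le
  rw [Set.indicator_of_mem hxE]
  refine le_trans (le_of_eq ?_) (Finset.single_le_sum_of_canonicallyOrdered
    (Finset.mem_range.2 (Nat.sub_lt hp one_pos)))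
  have : T (T^[returnTime T A x - 1] x) ∈ E := by
    rw [← Function.iterate_succ_apply' T, Nat.succ_eq_add_one, Nat.sub_add_cancel hp]
    exact hxE
  exact (Set.indicator_of_mem (s := T ⁻¹' E) this (1 : X → ENNReal)).symm

theorem measure_inter_preimage_inducedMap_iterate_le (hT : MeasurePreserving T m m)
    (hcons : Conservative T m) (hA : MeasurableSet A) {E : Set X} (hE : MeasurableSet E) (j : ℕ) :
    m (A ∩ (inducedMap T A)^[j] ⁻¹' E) ≤ m (A ∩ E) := by
  induction j with
  | zero => rfl
  | succ j ih =>
    refine le_trans ?_ ih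
    have hmeas : MeasurableSet ((inducedMap T A)^[j] ⁻¹' E) :=
      (measurable_inducedMap hT.measurable hA).iterate j hE
    refine le_trans (measure_mono_ae ?_)
      (measure_inter_preimage_inducedMap_le hT hcons hA (hA.inter hmeas))
    filter_upwards [ae_mem_recurrentPart hcons hA] with x hx
    rintro ⟨hxA, hxE⟩
    refine ⟨hxA, (inducedMap_mem_recurrentPart (hx hxA)).1, ?_⟩
    rw [Set.mem_preimage, Function.iterate_succ_apply] at hxE
    exact hxE

/-! ### The class `F_{log,T}` as a hereditary ring -/

theorem ofReal_log_one_add_le (n : ℕ) : ENNReal.ofReal (Real.log (1 + n)) ≤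
    ENNReal.ofReal (Real.log 2) + ENNReal.ofReal (Real.log n) := by
  rcases Nat.eq_zero_or_pos n with rfl | hn
  · simp
  have hn' : (1 : ℝ) ≤ n := by exact_mod_cast hn
  rw [← ENNReal.ofReal_add (Real.log_nonneg (by norm_num)) (Real.log_nonneg hn'),
    ← Real.log_mul (by norm_num) (by positivity)]
  exact ENNReal.ofReal_le_ofReal (Real.log_le_log (by positivity) (by linarith))

theorem FLog.lintegral_log_one_add_lt_top (hA : A ∈ FLog T m) :
    ∫⁻ x in A, ENNReal.ofReal (Real.log (1 + returnTime T A x)) ∂m < ⊤ := by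
  obtain ⟨_, _, hfin, hint⟩ := hA
  refine lt_of_le_of_lt (lintegral_mono fun x => ofReal_log_one_add_le _) ?_
  rw [lintegral_add_left measurable_const, setLIntegral_const]
  exact ENNReal.add_lt_top.2 ⟨ENNReal.mul_lt_top ENNReal.ofReal_lt_top hfin, hint⟩

/-- Kac's inequality for `B` is applied to `1_A log (1 + φ_A)`, whose sum over an excursion from
`B` dominates `log φ_B`. -/
theorem FLog.mono (hT : MeasurePreserving T m m) (hcons : Conservative T m)
    (hA : A ∈ FLog T m) (hB : MeasurableSet B) (hBA : B ⊆ A) (hB0 : m B ≠ 0) : B ∈ FLog T m := by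
  have hAm := hA.1
  refine ⟨hB, pos_iff_ne_zero.2 hB0, (measure_mono hBA).trans_lt hA.2.2.1, ?_⟩
  have hmeas : Measurable (A.indicator fun y => Real.log (1 + (returnTime T A y : ℝ))) :=
    (Real.measurable_log.comp (measurable_const.add (measurable_from_nat.comp
      (measurable_returnTime hT.measurable hAm)))).indicator hAm
  refine lt_of_le_of_lt (lintegral_ofReal_le_of_le_birkhoffSum hT hB hmeas.aemeasurable
    (ae_of_all _ (Set.indicator_nonneg fun y _ => Real.log_nonneg (by simp))) ?_) ?_
  · filter_upwards [ae_mem_recurrentPart hcons hAm, ae_mem_recurrentPart hcons hB]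
      with x hx hx' hxB
    refine le_trans (Real.log_le_log ?_ ?_) (log_one_add_le_birkhoffSum _ (hx (hBA hxB)))
    · exact_mod_cast one_le_returnTime_of_mem_recurrentPart (hx' hxB)
    · linarith
  · have : (fun x => ENNReal.ofReal (A.indicator
        (fun y => Real.log (1 + (returnTime T A y : ℝ))) x)) =
        A.indicator fun x => ENNReal.ofReal (Real.log (1 + (returnTime T A x : ℝ))) := by
      ext x
      by_cases hx : x ∈ A <;> simp [hx]
    rw [this, lintegral_indicator hAm]
    exact FLog.lintegral_log_one_add_lt_top hA

/-- Enlarging `A` to `C` does not increase the return time at almost every point of `A`. -/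
theorem lintegral_log_returnTime_le_of_subset (hcons : Conservative T m) (hA : MeasurableSet A)
    {C : Set X} (hAC : A ⊆ C) :
    ∫⁻ x in A, ENNReal.ofReal (Real.log (returnTime T C x)) ∂m ≤
      ∫⁻ x in A, ENNReal.ofReal (Real.log (returnTime T A x)) ∂m := by
  refine lintegral_mono_ae ?_
  rw [ae_restrict_iff' hA]
  filter_upwards [ae_mem_recurrentPart hcons hA] with x hx hxA
  have h1 := one_le_returnTime_of_mem_recurrentPart (hx hxA)
  have h2 : returnTime T C x ≤ returnTime T A x := returnTime_anti hAC (by omega)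
  have h3 : 1 ≤ returnTime T C x :=
    one_le_returnTime h1 (hAC (iterate_returnTime_mem (by omega)))
  exact ENNReal.ofReal_le_ofReal (Real.log_le_log (by exact_mod_cast h3) (by exact_mod_cast h2))

theorem isHereditaryRing_FLog_union_null (hT : MeasurePreserving T m m)
    (hcons : Conservative T m) :
    IsHereditaryRing (FLog T m ∪ {N : Set X | MeasurableSet N ∧ m N = 0}) := by
  set R := FLog T m ∪ {N : Set X | MeasurableSet N ∧ m N = 0}
  have hfin : ∀ A ∈ R, MeasurableSet A ∧ m A < ⊤ ∧
      ∫⁻ x in A, ENNReal.ofReal (Real.log (returnTime T A x)) ∂m < ⊤ := by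
    rintro A (hA | hA)
    · exact ⟨hA.1, hA.2.2⟩
    · refine ⟨hA.1, hA.2.trans_lt ENNReal.zero_lt_top, ?_⟩
      rw [setLIntegral_measure_zero _ _ hA.2]
      exact ENNReal.zero_lt_top
  have hmem : ∀ A, MeasurableSet A → m A < ⊤ →
      ∫⁻ x in A, ENNReal.ofReal (Real.log (returnTime T A x)) ∂m < ⊤ → A ∈ R := by
    intro A hA hAfin hint
    by_cases h0 : m A = 0
    · exact Or.inr ⟨hA, h0⟩
    · exact Or.inl ⟨hA, pos_iff_ne_zero.2 h0, hAfin, hint⟩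
  have hher : ∀ A ∈ R, ∀ B : Set X, MeasurableSet B → B ⊆ A → B ∈ R := by
    intro A hA B hB hBA
    by_cases h0 : m B = 0
    · exact Or.inr ⟨hB, h0⟩
    · rcases hA with hA | hA
      · exact Or.inl (FLog.mono hT hcons hA hB hBA h0)
      · exact absurd (measure_mono_null hBA hA.2) h0
  refine { empty_mem := Or.inr ⟨MeasurableSet.empty, measure_empty⟩,
           union_mem := fun A B hA hB => ?_,
           sdiff_mem := fun A B hA hB =>
            hher A hA _ ((hfin A hA).1.diff (hfin B hB).1) Set.sdiff_subset,
           hereditary := hher }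
  obtain ⟨hAm, hAfin, hAint⟩ := hfin A hA
  obtain ⟨hBm, hBfin, hBint⟩ := hfin B hB
  refine hmem _ (hAm.union hBm) (measure_union_lt_top hAfin hBfin) ?_
  refine lt_of_le_of_lt (lintegral_union_le _ _ _) (ENNReal.add_lt_top.2 ⟨?_, ?_⟩)
  · exact (lintegral_log_returnTime_le_of_subset hcons hAm Set.subset_union_left).trans_lt hAint
  · exact (lintegral_log_returnTime_le_of_subset hcons hBm Set.subset_union_right).trans_lt hBint

end Measure

/-! ### Growth of the number of visits -/

section Visits

/-- A partial-sum estimate: nonnegative terms of growth rate at most `exp (ε i)` have partial sums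
of the same growth rate. -/
theorem exists_log_sum_le {a : ℕ → ℕ} {ε : ℝ} (hε : 0 < ε)
    (ha : ∀ᶠ i in atTop, Real.log (a i) ≤ ε * i) :
    ∃ D : ℝ, ∀ j n : ℕ, n ≤ ∑ i ∈ Finset.range j, a i → Real.log n ≤ D + ε * j := by
  obtain ⟨i₀, hi₀⟩ := eventually_atTop.1 ha
  obtain ⟨C, hC1, hC⟩ : ∃ C : ℝ, 1 ≤ C ∧ ∀ i, (a i : ℝ) ≤ C * Real.exp (ε * i) := by
    refine ⟨1 + ∑ i ∈ Finset.range i₀, (a i : ℝ),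
      le_add_of_nonneg_right (Finset.sum_nonneg fun _ _ => Nat.cast_nonneg _), fun i => ?_⟩
    have hS : 0 ≤ ∑ i ∈ Finset.range i₀, (a i : ℝ) := Finset.sum_nonneg fun _ _ => Nat.cast_nonneg _
    have hexp : 1 ≤ Real.exp (ε * i) := Real.one_le_exp (by positivity)
    by_cases hi : i < i₀
    · have := Finset.single_le_sum (f := fun i => (a i : ℝ)) (fun _ _ => Nat.cast_nonneg _)
        (Finset.mem_range.2 hi)
      nlinarith
    · rcases Nat.eq_zero_or_pos (a i) with h0 | h0
      · rw [h0]
        exact (Nat.cast_zero (R := ℝ)).le.trans (by positivity)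
      · have := (Real.log_le_iff_le_exp (by exact_mod_cast h0)).1 (hi₀ i (not_lt.1 hi))
        nlinarith
  -- `K` is chosen so that `K exp (ε j) + C exp (ε j) ≤ K exp (ε (j + 1))`.
  have hgap : 0 < Real.exp ε - 1 := by linarith [Real.add_one_lt_exp hε.ne']
  set K := C / (Real.exp ε - 1)
  have hK : 0 < K := div_pos (by linarith) hgap
  have hKC : K * (Real.exp ε - 1) = C := div_mul_cancel₀ _ hgap.ne'
  have hsum : ∀ j : ℕ, ∑ i ∈ Finset.range j, (a i : ℝ) ≤ K * Real.exp (ε * j) := by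
    intro j
    induction j with
    | zero => simpa using hK.le
    | succ j ih =>
      have hsplit : Real.exp (ε * (j + 1 : ℕ)) = Real.exp (ε * j) * Real.exp ε := by
        rw [← Real.exp_add]
        push_cast
        ring_nf
      rw [Finset.sum_range_succ, hsplit]
      calc _ ≤ K * Real.exp (ε * j) + C * Real.exp (ε * j) := add_le_add ih (hC j)
        _ = _ := by rw [← hKC]; ring
  refine ⟨max (Real.log K) 0, fun j n hn => ?_⟩
  rcases Nat.eq_zero_or_pos n with rfl | hn0
  · simp only [Nat.cast_zero, Real.log_zero]
    positivity
  · have hn' : (n : ℝ) ≤ K * Real.exp (ε * j) := by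
      refine le_trans ?_ (hsum j)
      exact_mod_cast hn
    calc Real.log n ≤ Real.log (K * Real.exp (ε * j)) :=
          Real.log_le_log (by exact_mod_cast hn0) hn'
      _ = Real.log K + ε * j := by rw [Real.log_mul hK.ne' (Real.exp_ne_zero _), Real.log_exp]
      _ ≤ _ := by gcongr; exact le_max_left _ _

variable [MeasurableSpace X] {m : Measure X} {T : X → X} {A B : Set X}

/-- By the Borel–Cantelli lemma, along the visits of `A` the logarithm of the return time is
sublinear in the index of the visit. -/
theorem FLog.ae_eventually_log_returnTime_le (hT : MeasurePreserving T m m)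
    (hcons : Conservative T m) (hA : A ∈ FLog T m) {ε : ℝ} (hε : 0 < ε) :
    ∀ᵐ x ∂m, x ∈ A → ∀ᶠ i in atTop,
      Real.log (returnTime T A ((inducedMap T A)^[i] x)) ≤ ε * (i : ℕ) := by
  have hAm := hA.1
  set F : X → ℝ := fun x => Real.log (returnTime T A x) with hF
  have hFmeas : Measurable F :=
    Real.measurable_log.comp (measurable_from_nat.comp (measurable_returnTime hT.measurable hAm))
  set E : ℕ → Set X := fun i => {x | ε * i < F x} with hE
  have hEmeas : ∀ i, MeasurableSet (E i) := fun i => measurableSet_lt measurable_const hFmeas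
  -- The number of `i` with `ε i < F x` is at most `1 + F x / ε`.
  have hcount : ∀ x, ∑' i, (E i).indicator (1 : X → ENNReal) x ≤
      1 + ENNReal.ofReal (1 / ε) * ENNReal.ofReal (F x) := by
    intro x
    have hF0 : 0 ≤ F x := Real.log_natCast_nonneg _
    refine ENNReal.tsum_le_of_sum_range_le fun n => ?_
    have hcard : ∑ i ∈ Finset.range n, (E i).indicator (1 : X → ENNReal) x ≤
        ∑ i ∈ Finset.range (⌊F x / ε⌋₊ + 1), (1 : ENNReal) := by
      have h1 : ∑ i ∈ Finset.range n, (E i).indicator (1 : X → ENNReal) x =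
          ∑ i ∈ (Finset.range n).filter (fun i : ℕ => ε * i < F x), (1 : ENNReal) := by
        rw [Finset.sum_filter]
        rfl
      rw [h1]
      refine Finset.sum_le_sum_of_subset fun i hi => ?_
      rw [Finset.mem_filter] at hi
      refine Finset.mem_range.2 (Nat.lt_succ_of_le (Nat.le_floor ?_))
      rw [le_div_iff₀ hε]
      linarith [hi.2]
    refine hcard.trans ?_
    rw [← ENNReal.ofReal_mul (by positivity), ← ENNReal.ofReal_one,
      ← ENNReal.ofReal_add zero_le_one (by positivity),
      ← ENNReal.ofReal_sum_of_nonneg fun _ _ => zero_le_one]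
    refine ENNReal.ofReal_le_ofReal ?_
    have := Nat.floor_le (div_nonneg hF0 hε.le)
    simp only [Finset.sum_const, Finset.card_range, nsmul_eq_mul, mul_one, Nat.cast_add,
      Nat.cast_one]
    calc _ ≤ F x / ε + 1 := by linarith
      _ = _ := by ring
  have hsum : ∑' i, m (A ∩ (inducedMap T A)^[i] ⁻¹' E i) ≠ ⊤ := by
    refine ne_top_of_le_ne_top ?_ (ENNReal.tsum_le_tsum fun i =>
      measure_inter_preimage_inducedMap_iterate_le hT hcons hAm (hEmeas i) i)
    have : ∀ i, m (A ∩ E i) = ∫⁻ x in A, (E i).indicator 1 x ∂m := fun i => by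
      rw [lintegral_indicator_one (hEmeas i), Measure.restrict_apply (hEmeas i), Set.inter_comm]
    simp_rw [this]
    rw [← lintegral_tsum fun i => (measurable_one.indicator (hEmeas i)).aemeasurable]
    refine ne_top_of_le_ne_top ?_ (lintegral_mono hcount)
    rw [lintegral_add_left measurable_const, setLIntegral_const,
      lintegral_const_mul _ hFmeas.ennreal_ofReal]
    exact (ENNReal.add_lt_top.2 ⟨ENNReal.mul_lt_top ENNReal.one_lt_top hA.2.2.1,
      ENNReal.mul_lt_top ENNReal.ofReal_lt_top hA.2.2.2⟩).ne
  filter_upwards [ae_eventually_notMem hsum] with x hx hxA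
  filter_upwards [hx] with i hi
  exact not_lt.1 fun h => hi ⟨hxA, h⟩

/-- In other words, `log n = o(#{k < n : T^k x ∈ A})` for almost every `x ∈ A`. -/
theorem FLog.ae_exists_log_le_visits (hT : MeasurePreserving T m m)
    (hcons : Conservative T m) (hA : A ∈ FLog T m) {ε : ℝ} (hε : 0 < ε) :
    ∀ᵐ x ∂m, x ∈ A → ∃ D : ℝ, ∀ n : ℕ, Real.log n ≤ D + ε * visits T A n x := by
  filter_upwards [FLog.ae_eventually_log_returnTime_le hT hcons hA hε,
    ae_mem_recurrentPart hcons hA.1] with x hx hrec hxA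
  obtain ⟨D, hD⟩ := exists_log_sum_le hε (hx hxA)
  exact ⟨D, fun n => hD _ n (le_birkhoffSum_returnTime_visits (hrec hxA) n)⟩

/-- Under ergodicity and conservativity almost every orbit enters a set of positive measure. -/
theorem ae_exists_iterate_mem (hcons : Conservative T m) (herg : Ergodic T m)
    (hB : MeasurableSet B) (hB0 : m B ≠ 0) : ∀ᵐ x ∂m, ∃ k, T^[k] x ∈ B := by
  -- The set of points visiting `B` infinitely often is strictly invariant.
  set W : Set X := {x | ∃ᶠ n in atTop, T^[n] x ∈ B} with hW
  have hWmeas : MeasurableSet W := by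
    have : W = limsup (fun n => T^[n] ⁻¹' B) atTop := by
      ext x
      rw [mem_limsup_iff_frequently_mem]
      rfl
    rw [this]
    exact MeasurableSet.measurableSet_limsup fun n => herg.measurable.iterate n hB
  have hWinv : T ⁻¹' W = W := by
    ext x
    simp only [hW, Set.mem_preimage, Set.mem_ofPred_eq, ← Function.iterate_succ_apply]
    conv_rhs => rw [← map_add_atTop_eq_nat 1]
    rfl
  rcases herg.toPreErgodic.measure_self_or_compl_eq_zero hWmeas hWinv with h | h
  · refine absurd (measure_mono_null_ae ?_ h) hB0
    exact hcons.ae_mem_imp_frequently_image_mem hB.nullMeasurableSet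
  · filter_upwards [measure_eq_zero_iff_ae_notMem.1 h] with x hx
    exact (not_not.1 hx : x ∈ W).exists

/-! ### Ergodic sums of integrable functions -/

/-- A nonnegative function with positive integral is bounded below by a positive constant on a
measurable set of positive measure. -/
theorem exists_pos_le_of_mem_L1Pos {f : X → ℝ} (hf : f ∈ L1Pos m) :
    ∃ c : ℝ, 0 < c ∧ ∃ B, MeasurableSet B ∧ m B ≠ 0 ∧ ∀ x ∈ B, c ≤ f x := by
  obtain ⟨hint, h0, hpos⟩ := hf
  by_contra! hcon
  have hnull : ∀ p : ℕ, ∀ᵐ x ∂m, f x < 1 / (p + 1 : ℝ) := by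
    intro p
    have hnm : NullMeasurableSet {x | 1 / (p + 1 : ℝ) ≤ f x} m :=
      nullMeasurableSet_le aemeasurable_const hint.aemeasurable
    obtain ⟨B, hBsub, hB, hBeq⟩ := hnm.exists_measurable_subset_ae_eq
    have hB0 : m B = 0 := by
      by_contra hB0
      obtain ⟨x, hx, hlt⟩ := hcon (1 / (p + 1 : ℝ)) (by positivity) B hB hB0
      exact absurd (hBsub hx) (not_le.2 hlt)
    rw [measure_congr hBeq] at hB0
    filter_upwards [measure_eq_zero_iff_ae_notMem.1 hB0] with x hx
    exact not_le.1 hx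
  have hzero : f =ᵐ[m] 0 := by
    filter_upwards [ae_all_iff.2 hnull, h0] with x hx hx0
    refine le_antisymm (le_of_forall_pos_lt_add fun δ hδ => ?_) hx0
    obtain ⟨p, hp⟩ := exists_nat_one_div_lt hδ
    simpa using (hx p).trans hp
  rw [integral_congr_ae hzero] at hpos
  simp at hpos

/-- If for every `M` eventually `M log n ≤ D + S_n` with some constant `D`, then
`S_n / log n → ∞`. -/
theorem tendsto_div_log_atTop {S : ℕ → ℝ}
    (h : ∀ M : ℝ, 0 < M → ∃ D : ℝ, ∀ᶠ n : ℕ in atTop, M * Real.log n ≤ D + S n) :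
    Tendsto (fun n : ℕ => (1 / Real.log n) * S n) atTop atTop := by
  have hlog : Tendsto (fun n : ℕ => Real.log n) atTop atTop :=
    Real.tendsto_log_atTop.comp tendsto_natCast_atTop_atTop
  refine tendsto_atTop.2 fun b => ?_
  obtain ⟨D, hD⟩ := h (|b| + 1) (by positivity)
  filter_upwards [hD, hlog.eventually_ge_atTop D, hlog.eventually_gt_atTop 0] with n h1 h2 h3
  rw [one_div, inv_mul_eq_div, le_div_iff₀ h3]
  nlinarith [le_abs_self b]

/-- No ratio ergodic theorem is needed: if `c 1_B ≤ f`, then `A ∩ T⁻ᵏ B` has positive measure for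
some `k` and belongs to `F_{log,T}` by heredity, and its visits are dominated by `S_{n+k}(f)`. -/
theorem FLog.ae_tendsto_logAverage (hcons : Conservative T m) (herg : Ergodic T m)
    (hA : A ∈ FLog T m) {f : X → ℝ} (hf : f ∈ L1Pos m) :
    ∀ᵐ x ∂m, Tendsto (fun n : ℕ => logAverage T f n x) atTop atTop := by
  have hT : MeasurePreserving T m m := herg.toMeasurePreserving
  obtain ⟨c, hc, B, hB, hB0, hcB⟩ := exists_pos_le_of_mem_L1Pos hf
  obtain ⟨k, hk⟩ : ∃ k, m (A ∩ T^[k] ⁻¹' B) ≠ 0 := by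
    by_contra! hcon
    refine hA.2.1.ne' (measure_mono_null_ae ?_ (measure_iUnion_null hcon))
    filter_upwards [ae_exists_iterate_mem hcons herg hB hB0] with x ⟨k, hk⟩ hxA
    exact Set.mem_iUnion.2 ⟨k, hxA, hk⟩
  set A' := A ∩ T^[k] ⁻¹' B with hA'
  have hA'F : A' ∈ FLog T m :=
    FLog.mono hT hcons hA (hA.1.inter (hT.measurable.iterate k hB)) Set.inter_subset_left hk
  have hvis : ∀ᵐ x ∂m, ∀ p : ℕ, x ∈ A' →
      ∃ D : ℝ, ∀ n : ℕ, Real.log n ≤ D + 1 / (p + 1 : ℝ) * visits T A' n x :=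
    ae_all_iff.2 fun p => FLog.ae_exists_log_le_visits hT hcons hA'F (by positivity)
  have hvis' : ∀ᵐ x ∂m, ∀ j p : ℕ, T^[j] x ∈ A' →
      ∃ D : ℝ, ∀ n : ℕ, Real.log n ≤ D + 1 / (p + 1 : ℝ) * visits T A' n (T^[j] x) :=
    ae_all_iff.2 fun j => (hT.iterate j).quasiMeasurePreserving.ae hvis
  have hnonneg : ∀ᵐ x ∂m, ∀ i, 0 ≤ f (T^[i] x) :=
    ae_all_iff.2 fun i => (hT.iterate i).quasiMeasurePreserving.ae hf.2.1
  filter_upwards [hvis', hnonneg, ae_exists_iterate_mem hcons herg hA'F.1 hk]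
    with x hx h0 ⟨j, hj⟩
  have hdom : ∀ n, c * visits T A' n (T^[j] x) ≤ birkhoffSum T f (j + k + n) x := by
    intro n
    rw [birkhoffSum_add, visits, birkhoffSum, birkhoffSum, Nat.cast_sum, Finset.mul_sum]
    refine le_add_of_nonneg_of_le (Finset.sum_nonneg fun i _ => h0 i)
      (Finset.sum_le_sum fun i _ => ?_)
    have hcomm : T^[i] (T^[j + k] x) = T^[k] (T^[i] (T^[j] x)) := by
      simp only [← Function.iterate_add_apply]
      congr 1
      ring_nf
    by_cases hi : T^[i] (T^[j] x) ∈ A'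
    · rw [Set.indicator_of_mem hi, Nat.cast_one, mul_one, hcomm]
      exact hcB _ hi.2
    · rw [Set.indicator_of_notMem hi, Nat.cast_zero, mul_zero, ← Function.iterate_add_apply]
      exact h0 _
  refine tendsto_div_log_atTop fun M hM => ?_
  obtain ⟨p, hp⟩ := exists_nat_ge (M / c)
  have hMp : M ≤ c * (p + 1) := by
    rw [div_le_iff₀ hc] at hp
    linarith
  obtain ⟨D, hD⟩ := hx j p hj
  refine ⟨M * (D + Real.log (j + k + 1)), ?_⟩
  filter_upwards [eventually_ge_atTop (j + k + 1)] with N hN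
  obtain ⟨n, rfl⟩ := Nat.exists_eq_add_of_le hN
  have hS := hdom (n + 1)
  have hlog := hD (n + 1)
  have heq : j + k + 1 + n = j + k + (n + 1) := by ring
  rw [heq]
  set S := birkhoffSum T f (j + k + (n + 1)) x
  set v : ℝ := (visits T A' (n + 1) (T^[j] x) : ℝ)
  have hv : 0 ≤ v := Nat.cast_nonneg _
  have hsplit : Real.log ((j + k + (n + 1) : ℕ) : ℝ) ≤
      Real.log (j + k + 1) + Real.log ((n + 1 : ℕ) : ℝ) := by
    rw [← Real.log_mul (by positivity) (by positivity)]
    refine Real.log_le_log (by positivity) ?_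
    push_cast
    nlinarith [mul_nonneg (Nat.cast_nonneg (α := ℝ) n)
      (add_nonneg (Nat.cast_nonneg (α := ℝ) j) (Nat.cast_nonneg (α := ℝ) k))]
  have hMv : M * (1 / (p + 1 : ℝ) * v) ≤ c * v := by
    rw [← mul_assoc, mul_one_div]
    refine mul_le_mul_of_nonneg_right ?_ hv
    rwa [div_le_iff₀ (by positivity)]
  calc M * Real.log ((j + k + (n + 1) : ℕ) : ℝ)
      ≤ M * (Real.log (j + k + 1) + (D + 1 / (p + 1 : ℝ) * v)) := by
        gcongr
        exact hsplit.trans (by linarith)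
    _ = M * (D + Real.log (j + k + 1)) + M * (1 / (p + 1 : ℝ) * v) := by ring
    _ ≤ _ := by linarith

/-- If `log n ≤ C S_n(f)` for `n ≥ N` on a set `A` of finite positive measure, then
`log φ_A ≤ log N + C S_{φ_A}(f)` on `A`, which Kac's inequality integrates.  Such a set exists as
soon as the lower limit of `S_n(f) / log n` does not vanish almost everywhere. -/
theorem isLLB_of_not_ae_liminf_eq_zero [SigmaFinite m] (hT : MeasurePreserving T m m)
    {f : X → ℝ} (hf : f ∈ L1Pos m)
    (hlim : ¬ ∀ᵐ x ∂m, liminf (fun n : ℕ => ((logAverage T f n x : ℝ) : EReal)) atTop = 0) :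
    IsLLB T m := by
  obtain ⟨hint, h0, -⟩ := hf
  have hnonneg : ∀ᵐ x ∂m, ∀ i, 0 ≤ f (T^[i] x) :=
    ae_all_iff.2 fun i => (hT.iterate i).quasiMeasurePreserving.ae h0
  set D : ℕ × ℕ → Set X :=
    fun q => {x | ∀ n ≥ q.2, Real.log n ≤ (q.1 + 1) * birkhoffSum T f n x} with hD
  obtain ⟨⟨p, N⟩, hpN⟩ : ∃ q, m (D q) ≠ 0 := by
    by_contra! hcon
    refine hlim ?_
    filter_upwards [measure_eq_zero_iff_ae_notMem.1 (measure_iUnion_null hcon), hnonneg]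
      with x hx hx0
    have hS : ∀ n, 0 ≤ birkhoffSum T f n x := fun n => Finset.sum_nonneg fun i _ => hx0 i
    refine le_antisymm (not_lt.1 fun hpos => hx ?_) ?_
    · obtain ⟨c, hc0, hc⟩ := EReal.lt_iff_exists_real_btwn.1 hpos
      have hc0' : 0 < c := by exact_mod_cast hc0
      obtain ⟨p, hp⟩ := exists_nat_ge (1 / c)
      obtain ⟨N, hN⟩ := eventually_atTop.1 (eventually_lt_of_lt_liminf hc)
      refine Set.mem_iUnion.2 ⟨(p, N + 2), fun n hn => ?_⟩
      have hlt : c < logAverage T f n x := by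
        exact_mod_cast hN n (le_trans (Nat.le_add_right N 2) hn)
      have hn2 : N + 2 ≤ n := hn
      have hlog : 0 < Real.log n := Real.log_pos (by exact_mod_cast (by omega : 1 < n))
      rw [logAverage, one_div, inv_mul_eq_div, lt_div_iff₀ hlog] at hlt
      rw [div_le_iff₀ hc0'] at hp
      have := hS n
      calc Real.log n ≤ (p * c) * Real.log n := le_mul_of_one_le_left hlog.le hp
        _ = p * (c * Real.log n) := by ring
        _ ≤ p * birkhoffSum T f n x := by gcongr
        _ ≤ _ := by gcongr; linarith
    · refine le_liminf_of_le (by isBoundedDefault) (Eventually.of_forall fun n => ?_)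
      exact_mod_cast mul_nonneg (one_div_nonneg.2 (Real.log_natCast_nonneg n)) (hS n)
  have hSmeas : ∀ n, AEMeasurable (birkhoffSum T f n) m := fun n => by
    have : birkhoffSum T f n = ∑ k ∈ Finset.range n, f ∘ T^[k] := by
      ext x
      simp [birkhoffSum]
    rw [this]
    exact Finset.aemeasurable_sum _ fun k _ =>
      hint.aemeasurable.comp_quasiMeasurePreserving (hT.iterate k).quasiMeasurePreserving
  have hDmeas : NullMeasurableSet (D (p, N)) m := by
    have : D (p, N) =
        ⋂ n ≥ N, {x | Real.log n ≤ ((p : ℝ) + 1) * birkhoffSum T f n x} := by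
      ext x
      simp [hD]
    rw [this]
    exact NullMeasurableSet.iInter fun n => NullMeasurableSet.iInter fun _ =>
      nullMeasurableSet_le aemeasurable_const ((hSmeas n).const_mul _)
  obtain ⟨A₀, hA₀sub, hA₀, hA₀eq⟩ := hDmeas.exists_measurable_subset_ae_eq
  rw [← measure_congr hA₀eq] at hpN
  obtain ⟨A, hA, hAsub, hApos, hAfin⟩ :=
    Measure.exists_subset_measure_lt_top (r := 0) hA₀ (pos_iff_ne_zero.2 hpN)
  refine ⟨A, hA, hApos, hAfin, ?_⟩
  set g : X → ℝ := fun x => (p + 1) * f x with hg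
  have hgint : Integrable g m := hint.const_mul _
  have hg0 : 0 ≤ᵐ[m] g := by
    filter_upwards [h0] with x hx
    exact mul_nonneg (by positivity) hx
  have hKac := lintegral_ofReal_le_of_le_birkhoffSum hT hA (f := g)
    (F := fun x => Real.log (returnTime T A x) - Real.log N) hgint.aemeasurable hg0 (by
      filter_upwards [hnonneg] with x hx hxA
      have hsum : birkhoffSum T g (returnTime T A x) x =
          (p + 1) * birkhoffSum T f (returnTime T A x) x := by
        simp [birkhoffSum, hg, Finset.mul_sum]
      have hS : 0 ≤ birkhoffSum T f (returnTime T A x) x := Finset.sum_nonneg fun i _ => hx i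
      rw [hsum]
      by_cases hN : N ≤ returnTime T A x
      · have := hA₀sub (hAsub hxA) _ hN
        have h2 := Real.log_natCast_nonneg N
        simp only at this
        linarith
      · have hle : Real.log (returnTime T A x) ≤ Real.log N := by
          -- At a point that never returns the value is `0`, and `log 0 = 0`; conservativity is
          -- not needed here.
          rcases Nat.eq_zero_or_pos (returnTime T A x) with h | h
          · rw [h, Nat.cast_zero, Real.log_zero]
            exact Real.log_natCast_nonneg N
          · exact Real.log_le_log (by exact_mod_cast h) (by exact_mod_cast (not_le.1 hN).le)
        have : 0 ≤ ((p : ℝ) + 1) * birkhoffSum T f (returnTime T A x) x := by positivity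
        linarith)
  calc ∫⁻ x in A, ENNReal.ofReal (Real.log (returnTime T A x)) ∂m
      ≤ ∫⁻ x in A, (ENNReal.ofReal (Real.log N) +
          ENNReal.ofReal (Real.log (returnTime T A x) - Real.log N)) ∂m := by
        refine lintegral_mono fun x => ?_
        refine le_trans (le_of_eq ?_) ENNReal.ofReal_add_le
        rw [add_sub_cancel]
    _ = ENNReal.ofReal (Real.log N) * m A +
          ∫⁻ x in A, ENNReal.ofReal (Real.log (returnTime T A x) - Real.log N) ∂m := by
        rw [lintegral_add_left measurable_const, setLIntegral_const]
    _ < ⊤ := ENNReal.add_lt_top.2 ⟨ENNReal.mul_lt_top ENNReal.ofReal_lt_top hAfin,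
        hKac.trans_lt (lt_of_le_of_lt (lintegral_mono fun x => Real.ofReal_le_enorm _) hgint.2)⟩

theorem L1Pos_nonempty [SigmaFinite m] (hm : m ≠ 0) : (L1Pos m).Nonempty := by
  obtain ⟨B, hB, -, hpos, hfin⟩ := Measure.exists_subset_measure_lt_top (μ := m) (r := 0)
    MeasurableSet.univ (pos_iff_ne_zero.2 (by simpa using hm))
  refine ⟨B.indicator fun _ => 1, (integrable_indicator_iff hB).2
    (integrableOn_const hfin.ne), ae_of_all _ (Set.indicator_nonneg fun _ _ => zero_le_one), ?_⟩
  rw [integral_indicator hB, setIntegral_const, smul_eq_mul, mul_one]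
  exact ENNReal.toReal_pos hpos.ne' hfin.ne

theorem not_ae_liminf_eq_zero_of_ae_tendsto (hm : m ≠ 0) {f : X → ℝ}
    (h : ∀ᵐ x ∂m, Tendsto (fun n : ℕ => logAverage T f n x) atTop atTop) :
    ¬ ∀ᵐ x ∂m, liminf (fun n : ℕ => ((logAverage T f n x : ℝ) : EReal)) atTop = 0 := by
  intro h0
  have : (ae m).NeBot := ae_neBot.2 hm
  obtain ⟨x, hx, hx0⟩ := (h.and h0).exists
  have htop : Tendsto (fun n : ℕ => ((logAverage T f n x : ℝ) : EReal)) atTop (𝓝 ⊤) :=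
    EReal.tendsto_coe_nhds_top_iff.2 hx
  rw [htop.liminf_eq] at hx0
  exact absurd hx0 (by simp)

end Visits

/-! ### Factors -/

/-- On a factor the converse criterion applies to the restricted measure: if the factor were not
log-lower bounded, the ergodic sums of its integrable functions would contradict
`FLog.ae_tendsto_logAverage`. -/
theorem IsLLB.exists_mem_FLog_of_isFactor {C B : MeasurableSpace X} {m : Measure X} {T : X → X}
    (hm : m ≠ 0) (hcons : Conservative T m) (herg : Ergodic T m) (hL : IsLLB T m)
    (hC : IsFactor T m C) :
    ∃ A : Set X, MeasurableSet[C] A ∧ A ∈ FLog T m := by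
  have hle := hC.le
  have := hC.sigmaFinite
  have hTC : Measurable[C, C] T := fun A hA => hC.invariant A hA
  have hT : @MeasurePreserving X X C C T (m.trim hle) (m.trim hle) := by
    refine @MeasurePreserving.mk X X C C T _ _ hTC (@Measure.ext _ C _ _ fun A hA => ?_)
    rw [@Measure.map_apply X X C C _ _ hTC _ hA, trim_measurableSet_eq hle hA,
      trim_measurableSet_eq hle (hTC hA), herg.measure_preimage (hle A hA).nullMeasurableSet]
  have hm' : m.trim hle ≠ 0 := by
    intro h
    have huniv : m.trim hle Set.univ = 0 := by
      rw [h]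
      rfl
    exact hm (Measure.measure_univ_eq_zero.1 (measure_eq_zero_of_trim_eq_zero hle huniv))
  obtain ⟨f, hf⟩ := @L1Pos_nonempty X C (m.trim hle) _ hm'
  have hf' : f ∈ L1Pos m := by
    refine ⟨integrable_of_integrable_trim hle hf.1, ae_of_ae_trim hle hf.2.1, ?_⟩
    rw [integral_trim_ae hle hf.1.aestronglyMeasurable]
    exact hf.2.2
  obtain ⟨A₀, hA₀⟩ := hL
  obtain ⟨A, hA, hpos, hfin, hint⟩ := @isLLB_of_not_ae_liminf_eq_zero X C (m.trim hle) T _ hT f hf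
    fun h => not_ae_liminf_eq_zero_of_ae_tendsto hm
      (FLog.ae_tendsto_logAverage hcons herg hA₀ hf') (ae_of_ae_trim hle h)
  rw [trim_measurableSet_eq hle hA] at hpos hfin
  refine ⟨A, hA, hle A hA, hpos, hfin, ?_⟩
  have hmeas : Measurable[C] fun x => ENNReal.ofReal (Real.log (returnTime T A x : ℝ)) :=
    ENNReal.measurable_ofReal.comp (Real.measurable_log.comp (measurable_from_nat.comp
      (@measurable_returnTime X C T A hTC hA)))
  rwa [restrict_trim hle m hA, lintegral_trim hle hmeas] at hint

end LogLowerBounded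

/-! ### The dichotomy -/

/-- Here `T` is a conservative, ergodic, measure preserving transformation of a nonzero σ-finite measure
space (`Ergodic` includes that `T` preserves `m`).  The lower limit is taken in the extended reals.
As members of `F_{log,T}` have positive measure, the ring property is that of `F_{log,T}` together
with the null sets. -/
theorem proposition2p2 {X : Type*} [MeasurableSpace X] (m : Measure X) [SigmaFinite m] (hm : m ≠ 0)
    (T : X → X) (hcons : Conservative T m) (herg : Ergodic T m) :
    -- (i)
    ((LogLowerBounded.IsLLB T m ↔ ∃ f ∈ LogLowerBounded.L1Pos m,
        ∀ᵐ x ∂m, Tendsto (fun n : ℕ => LogLowerBounded.logAverage T f n x) atTop atTop) ∧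
      (LogLowerBounded.IsLLB T m ↔ ∀ f ∈ LogLowerBounded.L1Pos m,
        ∀ᵐ x ∂m, Tendsto (fun n : ℕ => LogLowerBounded.logAverage T f n x) atTop atTop)) ∧
    -- (ii)
    ((¬ LogLowerBounded.IsLLB T m ↔ ∃ f ∈ LogLowerBounded.L1Pos m,
        ∀ᵐ x ∂m,
          liminf (fun n : ℕ => ((LogLowerBounded.logAverage T f n x : ℝ) : EReal)) atTop = 0) ∧
      (¬ LogLowerBounded.IsLLB T m ↔ ∀ f ∈ LogLowerBounded.L1Pos m,
        ∀ᵐ x ∂m,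
          liminf (fun n : ℕ => ((LogLowerBounded.logAverage T f n x : ℝ) : EReal)) atTop = 0)) ∧
    -- (iii)
    (LogLowerBounded.IsLLB T m → ∀ C : MeasurableSpace X, LogLowerBounded.IsFactor T m C →
      ∃ A : Set X, MeasurableSet[C] A ∧ A ∈ LogLowerBounded.FLog T m) ∧
    -- (iv)
    LogLowerBounded.IsHereditaryRing
      (LogLowerBounded.FLog T m ∪ {N : Set X | MeasurableSet N ∧ m N = 0}) := by
  have hne : (LogLowerBounded.L1Pos m).Nonempty := LogLowerBounded.L1Pos_nonempty hm
  have hall : LogLowerBounded.IsLLB T m → ∀ f ∈ LogLowerBounded.L1Pos m,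
      ∀ᵐ x ∂m, Tendsto (fun n : ℕ => LogLowerBounded.logAverage T f n x) atTop atTop :=
    fun ⟨_, hA⟩ _ hf => LogLowerBounded.FLog.ae_tendsto_logAverage hcons herg hA hf
  have hliminf : ¬ LogLowerBounded.IsLLB T m → ∀ f ∈ LogLowerBounded.L1Pos m, ∀ᵐ x ∂m,
      liminf (fun n : ℕ => ((LogLowerBounded.logAverage T f n x : ℝ) : EReal)) atTop = 0 :=
    fun hL f hf => by_contra fun h =>
      hL (LogLowerBounded.isLLB_of_not_ae_liminf_eq_zero herg.toMeasurePreserving hf h)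
  have hex : (∃ f ∈ LogLowerBounded.L1Pos m,
      ∀ᵐ x ∂m, Tendsto (fun n : ℕ => LogLowerBounded.logAverage T f n x) atTop atTop) →
      LogLowerBounded.IsLLB T m := fun ⟨f, hf, h⟩ =>
    LogLowerBounded.isLLB_of_not_ae_liminf_eq_zero herg.toMeasurePreserving hf
      (LogLowerBounded.not_ae_liminf_eq_zero_of_ae_tendsto hm h)
  have hexlim : (∃ f ∈ LogLowerBounded.L1Pos m, ∀ᵐ x ∂m,
      liminf (fun n : ℕ => ((LogLowerBounded.logAverage T f n x : ℝ) : EReal)) atTop = 0) →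
      ¬ LogLowerBounded.IsLLB T m := fun ⟨f, hf, h⟩ hL =>
    LogLowerBounded.not_ae_liminf_eq_zero_of_ae_tendsto hm (hall hL f hf) h
  obtain ⟨f₀, hf₀⟩ := hne
  exact ⟨⟨⟨fun hL => ⟨f₀, hf₀, hall hL f₀ hf₀⟩, hex⟩, ⟨hall, fun h => hex ⟨f₀, hf₀, h f₀ hf₀⟩⟩⟩,
    ⟨⟨fun hL => ⟨f₀, hf₀, hliminf hL f₀ hf₀⟩, hexlim⟩,
      ⟨hliminf, fun h => hexlim ⟨f₀, hf₀, h f₀ hf₀⟩⟩⟩,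
    fun hL C hC => hL.exists_mem_FLog_of_isFactor hm hcons herg hC,
    LogLowerBounded.isHereditaryRing_FLog_union_null herg.toMeasurePreserving hcons⟩
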